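/- Let $C^1[0,1]$ be the Banach algebra of complex-valued continuously differentiable functions on $[0,1]$ (one-sided derivatives at the end points), with pointwise operations and norm $\|f\|=\sup_{[0,1]}|f|+\sup_{[0,1]}|f'|$. A bounded linear operator $T$ on a complex Banach space $B$ is called a Riesz operator if for every complex $\lambda\neq 0$: (a) $\lambda-T$ is open as a map onto its range; (b) the range $R(\lambda-T)$ is closed; (c) the dimension of the null space $N(\lambda-T)$ and the codimension of $R(\lambda-T)$ are finite and equal; (d) the chains $N((\lambda-T)^n)$ and $R((\lambda-T)^n)$, $n=0,1,2,\dots$, become stationary, and for the first time at the same index $n$; and moreover (e) every non-zero element of the spectrum of $T$ is an eigenvalue, and if there are infinitely many of them, they form a sequence tending to $0$. **Theorem 3.1.** Let $T$ be a unital endomorphism of $C^1[0,1]$ (that is, $T$ is linear and multiplicative with $T1=1$) induced by a map $\phi:[0,1]\to[0,1]$, i.e. $(Tf)(x)=f(\phi(x))$ for all $f\in C^1[0,1]$ and $x\in[0,1]$. Let $\phi_n$ denote the $n$-th iterate of $\phi$. Then $T$ is bounded, and $T$ is a Riesz operator if and only if there is a point $x_0\in[0,1]$ such that $$\bigcap_{n=0}^\infty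 \phi_n([0,1])=\{x_0\}\quad\text{and}\quad \phi'(x_0)=0 .$$ Moreover, for every $x_0\in[0,1]$ with these two properties, $\lim_{n\to\infty}\|T^n-L\|^{1/n}=0$, where $L$ is the operator $Lf=f(x_0)1$ on $C^1[0,1]$ and $\|\cdot\|$ is the operator norm. -/

import Mathlib

open Set Filter Topology unitInterval

noncomputable section

/-- The complex-valued functions on `[0,1]` that are continuously differentiable
(one-sided derivatives at the end points), as a subalgebra of `C([0,1], ℂ)`.
`IccExtend` only turns a function on the subtype into a function on `ℝ`;
`ContDiffOn` on `[0,1]` depends only on its values on `[0,1]`. -/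
def C1Subalgebra : Subalgebra ℂ C(I, ℂ) where
  carrier := {f | ContDiffOn ℝ 1 (IccExtend (zero_le_one' ℝ) f) (Icc 0 1)}
  mul_mem' := fun hf hg => ContDiffOn.mul hf hg
  add_mem' := fun hf hg => ContDiffOn.add hf hg
  algebraMap_mem' := fun _ => contDiffOn_const

/-- The algebra `C¹[0,1]`. It is a separate type because its norm is not the sup norm. -/
def C1I : Type := C1Subalgebra

namespace C1I

instance : CommRing C1I := inferInstanceAs (CommRing C1Subalgebra)

instance : Algebra ℂ C1I := inferInstanceAs (Algebra ℂ C1Subalgebra)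

/-- The underlying continuous function, as an algebra homomorphism. -/
def toCont : C1I →ₐ[ℂ] C(I, ℂ) := C1Subalgebra.val

theorem toCont_injective : Function.Injective toCont := Subtype.val_injective

instance : FunLike C1I I ℂ where
  coe f := toCont f
  coe_injective := fun _ _ h => toCont_injective (DFunLike.coe_injective h)

/-- `f` as a function on `ℝ`; only its values on `[0,1]` matter. -/
def ext (f : C1I) : ℝ → ℂ := IccExtend (zero_le_one' ℝ) f

theorem contDiffOn_ext (f : C1I) : ContDiffOn ℝ 1 f.ext (Icc 0 1) := Subtype.property f

/-- The derivative `f'`, one-sided at the end points. -/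
def deriv (f : C1I) : C(I, ℂ) where
  toFun x := derivWithin f.ext (Icc 0 1) x
  continuous_toFun := by
    have h := f.contDiffOn_ext.continuousOn_derivWithin (uniqueDiffOn_Icc zero_lt_one) le_rfl
    exact continuousOn_iff_continuous_domRestrict.mp h

theorem hasDerivWithinAt (f : C1I) (x : I) :
    HasDerivWithinAt f.ext (f.deriv x) (Icc 0 1) x :=
  ((f.contDiffOn_ext.differentiableOn one_ne_zero) x x.2).hasDerivWithinAt

theorem deriv_eq {f : C1I} {x : I} {c : ℂ} (h : HasDerivWithinAt f.ext c (Icc 0 1) x) :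
    f.deriv x = c :=
  h.derivWithin (uniqueDiffOn_Icc zero_lt_one x x.2)

theorem ext_apply (f : C1I) (x : I) : f.ext x = f x := IccExtend_val _ _ _

theorem deriv_add (f g : C1I) : (f + g).deriv = f.deriv + g.deriv :=
  ContinuousMap.ext fun x => deriv_eq ((f.hasDerivWithinAt x).add (g.hasDerivWithinAt x))

theorem deriv_smul (c : ℂ) (f : C1I) : (c • f).deriv = c • f.deriv :=
  ContinuousMap.ext fun x => deriv_eq ((f.hasDerivWithinAt x).const_smul c)

theorem deriv_mul (f g : C1I) :
    (f * g).deriv = f.deriv * toCont g + toCont f * g.deriv :=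
  ContinuousMap.ext fun x => deriv_eq (by
    have h := (f.hasDerivWithinAt x).mul (g.hasDerivWithinAt x)
    rw [ext_apply, ext_apply] at h
    exact h)

/-- The norm `‖f‖ = sup |f| + sup |f'|`. -/
instance : Norm C1I := ⟨fun f => ‖toCont f‖ + ‖f.deriv‖⟩

theorem norm_def (f : C1I) : ‖f‖ = ‖toCont f‖ + ‖f.deriv‖ := rfl

theorem deriv_neg (f : C1I) : (-f).deriv = -f.deriv := by
  have h := deriv_smul (-1) f
  rwa [neg_one_smul ℂ f, neg_one_smul ℂ f.deriv] at h

theorem deriv_zero : (0 : C1I).deriv = 0 := by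
  have h := deriv_smul 0 0
  rwa [zero_smul ℂ (0 : C1I), zero_smul ℂ (0 : C1I).deriv] at h

/-- The norm together with the properties of a norm on a ring. -/
abbrev ringNorm : RingNorm C1I where
  toFun f := ‖f‖
  map_zero' := by simp [norm_def, deriv_zero]
  add_le' f g := by
    simp only [norm_def, map_add, deriv_add]
    linarith [norm_add_le (toCont f) (toCont g), norm_add_le f.deriv g.deriv]
  neg' f := by simp [norm_def, deriv_neg]
  mul_le' f g := by
    simp only [norm_def, map_mul, deriv_mul]
    have h1 := norm_mul_le (toCont f) (toCont g)
    have h2 := norm_add_le (f.deriv * toCont g) (toCont f * g.deriv)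
    have h3 := norm_mul_le f.deriv (toCont g)
    have h4 := norm_mul_le (toCont f) g.deriv
    have h5 := mul_nonneg (norm_nonneg f.deriv) (norm_nonneg g.deriv)
    nlinarith
  eq_zero_of_map_eq_zero' f hf := by
    have h1 : ‖toCont f‖ = 0 := by
      have := norm_nonneg (toCont f)
      have := norm_nonneg f.deriv
      rw [norm_def] at hf
      linarith
    exact toCont_injective (by rw [norm_eq_zero.mp h1, map_zero])

instance : NormedCommRing C1I :=
  { (inferInstance : CommRing C1I), (inferInstance : Norm C1I), ringNorm.toNormedRing with }

instance : NormedAlgebra ℂ C1I where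
  norm_smul_le c f := by
    change ‖toCont (c • f)‖ + ‖(c • f).deriv‖ ≤ ‖c‖ * (‖toCont f‖ + ‖f.deriv‖)
    rw [map_smul, deriv_smul, norm_smul, norm_smul, mul_add]

theorem norm_toCont_le (f : C1I) : ‖toCont f‖ ≤ ‖f‖ := by
  rw [norm_def]; linarith [norm_nonneg f.deriv]

theorem norm_deriv_le (f : C1I) : ‖f.deriv‖ ≤ ‖f‖ := by
  rw [norm_def]; linarith [norm_nonneg (toCont f)]

theorem ext_eq_integral (f : C1I) (x : I) :
    f x = f 0 + ∫ t in (0 : ℝ)..x, IccExtend (zero_le_one' ℝ) f.deriv t := by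
  have h := intervalIntegral.integral_eq_sub_of_hasDeriv_right_of_le (a := 0) (b := (x : ℝ))
    (f := f.ext) (f' := IccExtend (zero_le_one' ℝ) f.deriv) x.2.1
    (f.contDiffOn_ext.continuousOn.mono (Icc_subset_Icc le_rfl x.2.2)) (fun t ht => by
      have ht' : t ∈ Icc (0 : ℝ) 1 := ⟨ht.1.le, ht.2.le.trans x.2.2⟩
      rw [IccExtend_of_mem _ _ ht']
      exact (f.hasDerivWithinAt ⟨t, ht'⟩).mono_of_mem_nhdsWithin
        (mem_nhdsWithin_of_mem_nhds (Icc_mem_nhds ht.1 (ht.2.trans_le x.2.2))))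
    (f.deriv.continuous.Icc_extend'.intervalIntegrable _ _)
  have h0 : f.ext 0 = f 0 := f.ext_apply 0
  rw [h, ext_apply, h0]
  ring

/-- `C¹[0,1]` is a Banach algebra. -/
instance : CompleteSpace C1I := by
  refine Metric.complete_of_cauchySeq_tendsto fun u hu => ?_
  have hdeq : ∀ f g : C1I, dist f g = ‖toCont f - toCont g‖ + ‖f.deriv - g.deriv‖ := by
    intro f g
    have h := deriv_add (f - g) g
    rw [sub_add_cancel] at h
    rw [dist_eq_norm, norm_def, map_sub, h, add_sub_cancel_right]
  have hC : CauchySeq fun n => toCont (u n) := by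
    refine Metric.cauchySeq_iff.mpr fun ε hε => ?_
    obtain ⟨N, hN⟩ := Metric.cauchySeq_iff.mp hu ε hε
    refine ⟨N, fun m hm n hn => lt_of_le_of_lt ?_ (hN m hm n hn)⟩
    rw [hdeq, dist_eq_norm]
    linarith [norm_nonneg ((u m).deriv - (u n).deriv)]
  have hD : CauchySeq fun n => (u n).deriv := by
    refine Metric.cauchySeq_iff.mpr fun ε hε => ?_
    obtain ⟨N, hN⟩ := Metric.cauchySeq_iff.mp hu ε hε
    refine ⟨N, fun m hm n hn => lt_of_le_of_lt ?_ (hN m hm n hn)⟩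
    rw [hdeq, dist_eq_norm]
    linarith [norm_nonneg (toCont (u m) - toCont (u n))]
  obtain ⟨F, hF⟩ := cauchySeq_tendsto_of_complete hC
  obtain ⟨G, hG⟩ := cauchySeq_tendsto_of_complete hD
  have hpt : ∀ y : I, Tendsto (fun n => u n y) atTop (𝓝 (F y)) := fun y =>
    ((continuous_eval_const (F := C(I, ℂ)) y).tendsto F).comp hF
  have hint : ∀ x : I, F x = F 0 + ∫ t in (0 : ℝ)..x, IccExtend (zero_le_one' ℝ) G t := by
    intro x
    have h1 : Tendsto (fun n => ∫ t in (0 : ℝ)..x, IccExtend (zero_le_one' ℝ) (u n).deriv t)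
        atTop (𝓝 (∫ t in (0 : ℝ)..x, IccExtend (zero_le_one' ℝ) G t)) := by
      rw [tendsto_iff_norm_sub_tendsto_zero]
      have hz := (tendsto_iff_norm_sub_tendsto_zero.mp hG).mul_const |(x : ℝ) - 0|
      rw [zero_mul] at hz
      refine squeeze_zero (fun n => norm_nonneg _) (fun n => ?_) hz
      rw [← intervalIntegral.integral_sub
        ((u n).deriv.continuous.Icc_extend'.intervalIntegrable _ _)
        (G.continuous.Icc_extend'.intervalIntegrable _ _)]
      exact intervalIntegral.norm_integral_le_of_norm_le_const fun t _ =>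
        ((u n).deriv - G).norm_coe_le_norm (projIcc 0 1 (zero_le_one' ℝ) t)
    have h2 := (hpt 0).add h1
    exact tendsto_nhds_unique (hpt x) (h2.congr fun n => (ext_eq_integral (u n) x).symm)
  have hder : ∀ x : I, HasDerivWithinAt (IccExtend (zero_le_one' ℝ) F) (G x) (Icc 0 1) x := by
    intro x
    have hc : Continuous (IccExtend (zero_le_one' ℝ) G) := G.continuous.Icc_extend'
    have h := ((hc.integral_hasStrictDerivAt 0 (x : ℝ)).hasDerivAt.const_add (F 0)).hasDerivWithinAt
      (s := Icc (0 : ℝ) 1)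
    rw [IccExtend_val] at h
    refine h.congr (fun t ht => ?_) ?_
    · rw [IccExtend_of_mem _ _ ht]; exact hint ⟨t, ht⟩
    · rw [IccExtend_val]; exact hint x
  have hmem : ContDiffOn ℝ 1 (IccExtend (zero_le_one' ℝ) F) (Icc 0 1) := by
    rw [contDiffOn_one_iff_derivWithin (uniqueDiffOn_Icc zero_lt_one)]
    refine ⟨fun x hx => (hder ⟨x, hx⟩).differentiableWithinAt, ?_⟩
    refine (G.continuous.Icc_extend' (h := zero_le_one' ℝ)).continuousOn.congr fun x hx => ?_
    rw [IccExtend_of_mem _ _ hx]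
    exact (hder ⟨x, hx⟩).derivWithin (uniqueDiffOn_Icc zero_lt_one x hx)
  let f : C1I := (⟨F, hmem⟩ : C1Subalgebra)
  have hfF : toCont f = F := rfl
  have hfG : f.deriv = G := ContinuousMap.ext fun x => deriv_eq (hder x)
  refine ⟨f, tendsto_iff_dist_tendsto_zero.mpr ?_⟩
  have h := (tendsto_iff_norm_sub_tendsto_zero.mp hF).add (tendsto_iff_norm_sub_tendsto_zero.mp hG)
  rw [add_zero] at h
  refine h.congr fun n => ?_
  rw [hdeq, hfF, hfG]

/-- The rank one operator `L f = f(x₀) 1`. -/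
def evalOne (x₀ : I) : C1I →L[ℂ] C1I :=
  LinearMap.mkContinuous
    { toFun := fun f => algebraMap ℂ C1I (f x₀)
      map_add' := fun f g => map_add (algebraMap ℂ C1I) (f x₀) (g x₀)
      map_smul' := fun c f =>
        (map_mul (algebraMap ℂ C1I) c (f x₀)).trans (Algebra.smul_def _ _).symm } ‖(1 : C1I)‖
    fun f => by
      have h : ‖f x₀‖ ≤ ‖f‖ := ((toCont f).norm_coe_le_norm x₀).trans (norm_toCont_le f)
      change ‖algebraMap ℂ C1I (f x₀)‖ ≤ _
      rw [Algebra.algebraMap_eq_smul_one, norm_smul, mul_comm]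
      exact mul_le_mul_of_nonneg_left h (norm_nonneg _)

theorem evalOne_apply (x₀ : I) (f : C1I) (x : I) : evalOne x₀ f x = f x₀ := rfl

end C1I

/-- `p` is the length of the chain `c 0, c 1, c 2, …`: the first index from which on the next
member is the same. -/
def IsChainLength {E : Type*} [AddCommGroup E] [Module ℂ E] (c : ℕ → Submodule ℂ E) (p : ℕ) :
    Prop :=
  IsLeast {n | c n = c (n + 1)} p

/-- The operator `λ - T`. -/
def lambdaSub {E : Type*} [NormedAddCommGroup E] [NormedSpace ℂ E] (T : E →L[ℂ] E) (μ : ℂ) :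
    E →L[ℂ] E :=
  μ • ContinuousLinearMap.id ℂ E - T

/-- The kernel `N(S)`. -/
abbrev nullSpace {E : Type*} [NormedAddCommGroup E] [NormedSpace ℂ E] (S : E →L[ℂ] E) :
    Submodule ℂ E :=
  LinearMap.ker (S : E →ₗ[ℂ] E)

/-- The range `R(S)`. -/
abbrev rangeSpace {E : Type*} [NormedAddCommGroup E] [NormedSpace ℂ E] (S : E →L[ℂ] E) :
    Submodule ℂ E :=
  LinearMap.range (S : E →ₗ[ℂ] E)

/-- Riesz operators on a complex Banach space. In (a), as usual for operators that need not be
surjective, "open" means open as a map onto the range. -/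
structure IsRieszOperator {E : Type*} [NormedAddCommGroup E] [NormedSpace ℂ E] [CompleteSpace E]
    (T : E →L[ℂ] E) : Prop where
  /-- (a) `λ - T` maps open sets to relatively open subsets of its range. -/
  isOpenMap : ∀ μ : ℂ, μ ≠ 0 → IsOpenMap (Set.rangeFactorization (lambdaSub T μ))
  /-- (b) `λ - T` has closed range. -/
  isClosed_range : ∀ μ : ℂ, μ ≠ 0 → IsClosed (Set.range (lambdaSub T μ))
  /-- (c) the kernel of `λ - T` is finite dimensional … -/
  finite_ker : ∀ μ : ℂ, μ ≠ 0 → FiniteDimensional ℂ (nullSpace (lambdaSub T μ))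
  /-- … the range has finite codimension … -/
  finite_coker : ∀ μ : ℂ, μ ≠ 0 → FiniteDimensional ℂ (E ⧸ rangeSpace (lambdaSub T μ))
  /-- … and the two numbers are equal. -/
  dim_eq_codim : ∀ μ : ℂ, μ ≠ 0 →
    Module.finrank ℂ (nullSpace (lambdaSub T μ)) =
      Module.finrank ℂ (E ⧸ rangeSpace (lambdaSub T μ))
  /-- (d) the null chain and the image chain of `λ - T` have the same finite length. -/
  chains : ∀ μ : ℂ, μ ≠ 0 → ∃ p : ℕ,
    IsChainLength (fun n => nullSpace (lambdaSub T μ ^ n)) p ∧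
      IsChainLength (fun n => rangeSpace (lambdaSub T μ ^ n)) p
  /-- (e) the non-zero spectrum consists of eigenvalues … -/
  hasEigenvalue : ∀ μ ∈ spectrum ℂ T, μ ≠ 0 → Module.End.HasEigenvalue (T : E →ₗ[ℂ] E) μ
  /-- … and, if there are infinitely many of them, they form a sequence tending to `0`. -/
  tendsto_zero : (spectrum ℂ T \ {0}).Infinite →
    ∃ u : ℕ → ℂ, Function.Injective u ∧ Set.range u = spectrum ℂ T \ {0} ∧
      Tendsto u atTop (𝓝 0)

/-- `φ` has a derivative at `x` within `[0,1]`, equal to `c`. -/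
def HasDerivAtUnit (φ : I → I) (c : ℝ) (x : I) : Prop :=
  HasDerivWithinAt (IccExtend (zero_le_one' ℝ) fun t => (φ t : ℝ)) c (Icc 0 1) x

end

/-! Everything reduces to the quasinilpotency of `S - L`, where `L f = f(x₀) 1` at a fixed point
`x₀`. Since `L` is idempotent and `SL = LS = L`, the factorization `μ(μ - S) = (μ - L)(μ - (S - L))`
holds, and `(S - L)^n = S^n - L` for `n ≥ 1`.

Sufficiency: `(S^n f)'` is `f' ∘ φ_n` times the product of `φ'` along an orbit. By compactness all
orbits eventually stay where `|φ'| < ε`, so `‖(S - L)^n‖` decays faster than any geometric sequence.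
The factorization then gives all Riesz conditions, and Gelfand's formula gives the limit.

Necessity: invariant functions form a finite-dimensional subalgebra, so they are constant on the
connected interval. If `S f = μ f`, then `|f|^p` is `C¹` for `p > 1` and is an eigenfunction for
`|μ|^p`. Letting `p` decrease to 1 would make the eigenvalues accumulate at `|μ| ≠ 0` unless `|μ| =
1`. Then `|f|²` is constant, which forces `μ = 1` because `f(x₀) = 0` otherwise. Equality of nullity
and codimension handles `μ = 1`, so `S - L` is quasinilpotent. Testing this on the coordinate
function gives both conditions on `φ`. -/

section RieszCriterion

/-! ### Riesz operators as quasinilpotent perturbations of an idempotent -/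

variable {E : Type*} [NormedAddCommGroup E] [NormedSpace ℂ E]

theorem lambdaSub_eq_algebraMap_sub (T : E →L[ℂ] E) (μ : ℂ) :
    lambdaSub T μ = algebraMap ℂ (E →L[ℂ] E) μ - T := by
  rw [Algebra.algebraMap_eq_smul_one]
  rfl

theorem notMem_spectrum_iff_isUnit_lambdaSub {T : E →L[ℂ] E} {μ : ℂ} :
    μ ∉ spectrum ℂ T ↔ IsUnit (lambdaSub T μ) := by
  rw [lambdaSub_eq_algebraMap_sub]
  exact spectrum.notMem_iff

/-- If `L` is an idempotent that absorbs `T`, then `μ(μ - T)` factors through `T - L`. -/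
theorem smul_lambdaSub_eq_mul {T L : E →L[ℂ] E} (hTL : T * L = L) (hLT : L * T = L)
    (hLL : L * L = L) (μ : ℂ) :
    μ • lambdaSub T μ = lambdaSub L μ * lambdaSub (T - L) μ ∧
      μ • lambdaSub T μ = lambdaSub (T - L) μ * lambdaSub L μ := by
  simp only [lambdaSub_eq_algebraMap_sub, Algebra.algebraMap_eq_smul_one]
  constructor
  · simp only [sub_mul, mul_sub, smul_mul_assoc, mul_smul_comm, one_mul, mul_one, hLT, hLL]
    module
  · simp only [sub_mul, mul_sub, smul_mul_assoc, mul_smul_comm, one_mul, mul_one, hTL, hLL]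
    module

theorem isUnit_lambdaSub_of_idempotent {L : E →L[ℂ] E} (hLL : L * L = L) {μ : ℂ}
    (h0 : μ ≠ 0) (h1 : μ ≠ 1) : IsUnit (lambdaSub L μ) := by
  rw [← notMem_spectrum_iff_isUnit_lambdaSub]
  intro h
  have := IsIdempotentElem.spectrum_subset ℂ (p := L) hLL h
  simp_all

/-- Away from `0` and `1`, the spectrum of `T` is the spectrum of `T - L`. -/
theorem isUnit_lambdaSub_iff_sub {T L : E →L[ℂ] E} (hTL : T * L = L) (hLT : L * T = L)
    (hLL : L * L = L) {μ : ℂ} (h0 : μ ≠ 0) (h1 : μ ≠ 1) :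
    IsUnit (lambdaSub T μ) ↔ IsUnit (lambdaSub (T - L) μ) := by
  have h := (smul_lambdaSub_eq_mul hTL hLT hLL μ).1
  have hL := isUnit_lambdaSub_of_idempotent hLL h0 h1
  have hs : IsUnit (μ • lambdaSub T μ) ↔ IsUnit (lambdaSub T μ) :=
    isUnit_smul_iff (Units.mk0 μ h0) (lambdaSub T μ)
  obtain ⟨u, hu⟩ := hL
  rw [← hs, h, ← hu]
  exact Units.isUnit_units_mul u _

theorem isOpenMap_rangeFactorization_of_isClosed_range [CompleteSpace E] (S : E →L[ℂ] E)
    (h : IsClosed (Set.range S)) : IsOpenMap (Set.rangeFactorization S) := by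
  have : CompleteSpace S.range := by
    refine IsClosed.completeSpace_coe (hs := ?_)
    rwa [LinearMap.coe_range]
  exact S.rangeRestrict.isOpenMap (LinearMap.surjective_rangeRestrict _)

/-- The two factorizations at `μ = 1` give `1 - T = (1 - L) U = U (1 - L)` with `U` invertible. As
`1 - L` is idempotent, its powers do not change, and the invertible factor affects neither kernel
nor range. -/
theorem ker_and_range_pow_lambdaSub_one {T L : E →L[ℂ] E} (hTL : T * L = L) (hLT : L * T = L)
    (hLL : L * L = L) (hU : IsUnit (lambdaSub (T - L) 1)) {n : ℕ} (hn : n ≠ 0) :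
    nullSpace (lambdaSub T 1 ^ n) = rangeSpace L ∧
      rangeSpace (lambdaSub T 1 ^ n) = nullSpace L := by
  set U := lambdaSub (T - L) 1 with hUdef
  have hL1 : lambdaSub L 1 = 1 - L := by rw [lambdaSub_eq_algebraMap_sub, map_one]
  have h := smul_lambdaSub_eq_mul hTL hLT hLL 1
  rw [one_smul, hL1] at h
  have hcomm : Commute (1 - L) U := h.1.symm.trans h.2
  have hidem : (1 - L) ^ n = 1 - L := (IsIdempotentElem.one_sub (a := L) hLL).pow_eq hn
  have hpow : lambdaSub T 1 ^ n = (1 - L) * U ^ n := by rw [h.1, hcomm.mul_pow, hidem]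
  have hpow' : lambdaSub T 1 ^ n = U ^ n * (1 - L) := by rw [hpow, (hcomm.pow_right n).eq]
  have hLLx : ∀ x, L (L x) = L x := fun x => DFunLike.congr_fun hLL x
  obtain ⟨V, hV⟩ := hU.pow n
  have hinv : ∀ x, (↑V⁻¹ : E →L[ℂ] E) ((U ^ n) x) = x := fun x => by
    rw [← hV]; exact DFunLike.congr_fun V.inv_mul x
  have hinv' : ∀ x, (U ^ n) ((↑V⁻¹ : E →L[ℂ] E) x) = x := fun x => by
    rw [← hV]; exact DFunLike.congr_fun V.mul_inv x
  constructor
  · ext x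
    constructor
    · intro hx
      have hx' : (U ^ n) (x - L x) = 0 := by
        rw [nullSpace, hpow'] at hx
        exact hx
      have := hinv (x - L x)
      rw [hx', map_zero] at this
      exact ⟨x, (sub_eq_zero.mp this.symm).symm⟩
    · rintro ⟨y, rfl⟩
      rw [nullSpace, hpow']
      change (U ^ n) (L y - L (L y)) = 0
      rw [hLLx, sub_self, map_zero]
  · ext x
    constructor
    · rintro ⟨y, rfl⟩
      rw [hpow]
      change L ((U ^ n) y - L ((U ^ n) y)) = 0
      rw [map_sub, hLLx, sub_self]
    · intro hx
      refine ⟨(↑V⁻¹ : E →L[ℂ] E) x, ?_⟩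
      rw [hpow]
      change (U ^ n) ((↑V⁻¹ : E →L[ℂ] E) x) - L ((U ^ n) ((↑V⁻¹ : E →L[ℂ] E) x)) = x
      rw [hinv', show L x = 0 from hx, sub_zero]

/-- If `L` is a non-zero idempotent of finite rank that absorbs `T` on both sides and `T - L` is
quasinilpotent, then `T` is a Riesz operator. -/
theorem isRieszOperator_of_quasinilpotent_sub [CompleteSpace E] {T L : E →L[ℂ] E}
    (hTL : T * L = L) (hLT : L * T = L) (hLL : L * L = L) (hL0 : L ≠ 0)
    [FiniteDimensional ℂ (rangeSpace L)] (hQ : spectrum ℂ (T - L) ⊆ {0}) :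
    IsRieszOperator T := by
  have hQU : ∀ μ : ℂ, μ ≠ 0 → IsUnit (lambdaSub (T - L) μ) := fun μ h =>
    notMem_spectrum_iff_isUnit_lambdaSub.mp fun h' => h (hQ h')
  have hunit : ∀ μ : ℂ, μ ≠ 0 → μ ≠ 1 → IsUnit (lambdaSub T μ) := fun μ h0 h1 =>
    (isUnit_lambdaSub_iff_sub hTL hLT hLL h0 h1).mpr (hQU μ h0)
  have hbij : ∀ μ : ℂ, μ ≠ 0 → μ ≠ 1 → Function.Bijective (lambdaSub T μ) := fun μ h0 h1 =>
    ContinuousLinearMap.isUnit_iff_bijective.mp (hunit μ h0 h1)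
  have hker : ∀ μ : ℂ, μ ≠ 0 → μ ≠ 1 → nullSpace (lambdaSub T μ) = ⊥ := fun μ h0 h1 =>
    LinearMap.ker_eq_bot.mpr (hbij μ h0 h1).1
  have hran : ∀ μ : ℂ, μ ≠ 0 → μ ≠ 1 → rangeSpace (lambdaSub T μ) = ⊤ := fun μ h0 h1 =>
    LinearMap.range_eq_top.mpr (hbij μ h0 h1).2
  have hone : ∀ n : ℕ, n ≠ 0 → nullSpace (lambdaSub T 1 ^ n) = rangeSpace L ∧
      rangeSpace (lambdaSub T 1 ^ n) = nullSpace L := fun n hn =>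
    ker_and_range_pow_lambdaSub_one hTL hLT hLL (hQU 1 one_ne_zero) hn
  have hone1 := hone 1 one_ne_zero
  rw [pow_one] at hone1
  have hspec : spectrum ℂ T \ {0} ⊆ {1} := by
    rintro μ ⟨hμ, h0⟩
    by_contra h1
    exact notMem_spectrum_iff_isUnit_lambdaSub.mpr (hunit μ h0 h1) hμ
  have hclosed : ∀ μ : ℂ, μ ≠ 0 → IsClosed (Set.range (lambdaSub T μ)) := by
    intro μ h0
    by_cases h1 : μ = 1
    · subst h1
      have : Set.range (lambdaSub T 1) = L ⁻¹' {0} := by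
        ext x
        exact SetLike.ext_iff.mp hone1.2 x
      rw [this]
      exact isClosed_singleton.preimage L.continuous
    · rw [(hbij μ h0 h1).2.range_eq]
      exact isClosed_univ
  have hfin : FiniteDimensional ℂ (E ⧸ nullSpace L) :=
    (L : E →ₗ[ℂ] E).quotKerEquivRange.symm.finiteDimensional
  obtain ⟨x, hx⟩ : ∃ x, L x ≠ 0 := by
    by_contra! h
    exact hL0 (ContinuousLinearMap.ext h)
  have hLLx : ∀ x, L (L x) = L x := fun x => DFunLike.congr_fun hLL x
  -- The last clause of (e) is vacuous, because the non-zero spectrum lies in `{1}`.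
  refine ⟨fun μ h0 => isOpenMap_rangeFactorization_of_isClosed_range _ (hclosed μ h0), hclosed,
    fun μ h0 => ?_, fun μ h0 => ?_, fun μ h0 => ?_, fun μ h0 => ?_, fun μ hμ h0 => ?_,
    fun h => absurd ((finite_singleton 1).subset hspec) h⟩
  · by_cases h1 : μ = 1
    · subst h1
      rw [hone1.1]
      infer_instance
    · rw [hker μ h0 h1]
      infer_instance
  · by_cases h1 : μ = 1
    · subst h1
      rw [hone1.2]
      exact hfin
    · rw [hran μ h0 h1]
      infer_instance
  · by_cases h1 : μ = 1
    · subst h1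
      rw [hone1.1, hone1.2]
      exact (L : E →ₗ[ℂ] E).quotKerEquivRange.finrank_eq.symm
    · rw [hker μ h0 h1, hran μ h0 h1, finrank_bot, Module.finrank_zero_of_subsingleton]
  · by_cases h1 : μ = 1
    · subst h1
      -- Both chains stop at 1 and not at 0: the vector `L x ≠ 0` lies in `R(L)` but not in the zero
      -- kernel, and not in `N(L)` although the range at index 0 is everything.
      refine ⟨1, ⟨?_, ?_⟩, ⟨?_, ?_⟩⟩
      · exact (hone 1 one_ne_zero).1.trans (hone 2 two_ne_zero).1.symm
      · intro n hn
        rw [Nat.one_le_iff_ne_zero]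
        rintro rfl
        have h : nullSpace (lambdaSub T 1 ^ 0) = rangeSpace L :=
          Eq.trans hn (hone 1 one_ne_zero).1
        have : L x ∈ nullSpace (lambdaSub T 1 ^ 0) := h ▸ ⟨x, rfl⟩
        exact hx this
      · exact (hone 1 one_ne_zero).2.trans (hone 2 two_ne_zero).2.symm
      · intro n hn
        rw [Nat.one_le_iff_ne_zero]
        rintro rfl
        have h : rangeSpace (lambdaSub T 1 ^ 0) = nullSpace L :=
          Eq.trans hn (hone 1 one_ne_zero).2
        have : L x ∈ nullSpace L := h ▸ ⟨L x, rfl⟩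
        exact hx ((hLLx x).symm.trans this)
    · have hp : ∀ n : ℕ, Function.Bijective ⇑(lambdaSub T μ ^ n) := fun n =>
        ContinuousLinearMap.isUnit_iff_bijective.mp ((hunit μ h0 h1).pow n)
      have hk : ∀ n : ℕ, nullSpace (lambdaSub T μ ^ n) = ⊥ := fun n =>
        LinearMap.ker_eq_bot.mpr (hp n).1
      have hr : ∀ n : ℕ, rangeSpace (lambdaSub T μ ^ n) = ⊤ := fun n =>
        LinearMap.range_eq_top.mpr (hp n).2
      exact ⟨0, ⟨(hk 0).trans (hk 1).symm, fun _ _ => Nat.zero_le _⟩,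
        ⟨(hr 0).trans (hr 1).symm, fun _ _ => Nat.zero_le _⟩⟩
  · obtain rfl : μ = 1 := hspec ⟨hμ, h0⟩
    refine Module.End.hasEigenvalue_of_hasEigenvector (x := L x) ⟨?_, hx⟩
    rw [Module.End.mem_eigenspace_iff, one_smul]
    exact DFunLike.congr_fun hTL x

end RieszCriterion

/-! ### Quasinilpotent elements of a Banach algebra -/

/-- Gelfand's formula for quasinilpotent elements. -/
theorem tendsto_norm_pow_one_div_of_spectrum_subset {A : Type*} [NormedRing A] [NormedAlgebra ℂ A]
    [CompleteSpace A] {a : A} (h : spectrum ℂ a ⊆ {0}) :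
    Tendsto (fun n : ℕ => ‖a ^ n‖ ^ (1 / (n : ℝ))) atTop (𝓝 0) := by
  have hr : spectralRadius ℂ a = 0 := by
    rw [spectralRadius]
    simp only [ENNReal.iSup_eq_zero]
    intro k hk
    rw [h hk]
    simp
  have := spectrum.pow_norm_pow_one_div_tendsto_nhds_spectralRadius a
  rw [hr] at this
  have h2 := (ENNReal.tendsto_toReal ENNReal.zero_ne_top).comp this
  refine h2.congr fun n => ?_
  exact ENNReal.toReal_ofReal (by positivity)

/-- An element whose powers decay faster than every geometric sequence is quasinilpotent. -/
theorem spectrum_subset_zero_of_norm_pow_le {A : Type*} [NormedRing A] [NormedAlgebra ℂ A]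
    [CompleteSpace A] {a : A}
    (h : ∀ ε : ℝ, 0 < ε → ∃ (C : ℝ) (N : ℕ), ∀ m : ℕ, ‖a ^ (N + m)‖ ≤ C * ε ^ m) :
    spectrum ℂ a ⊆ {0} := by
  intro μ hμ
  by_contra h0
  have hpos : 0 < ‖μ‖ := norm_pos_iff.mpr h0
  -- With ratio `‖μ‖ / 2`, the bound on `‖μ‖ ^ (N + m)` leaves `‖μ‖ ^ N` below a multiple of `2⁻ᵐ`
  -- for every `m`.
  obtain ⟨C, N, hC⟩ := h (‖μ‖ / 2) (by positivity)
  have key : ∀ m : ℕ, ‖μ‖ ^ N ≤ C * ‖(1 : A)‖ * (1 / 2) ^ m := by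
    intro m
    have h1 := spectrum.norm_le_norm_mul_of_mem (spectrum.pow_mem_pow a (N + m) hμ)
    rw [norm_pow] at h1
    have h2 := h1.trans (mul_le_mul_of_nonneg_right (hC m) (norm_nonneg _))
    have h3 : ‖μ‖ ^ N * ‖μ‖ ^ m ≤ C * ‖(1 : A)‖ * (1 / 2) ^ m * ‖μ‖ ^ m := by
      rw [← pow_add]
      refine h2.trans_eq ?_
      rw [div_pow, div_pow]
      ring
    exact le_of_mul_le_mul_right h3 (by positivity)
  have hlim : Tendsto (fun m : ℕ => C * ‖(1 : A)‖ * (1 / 2 : ℝ) ^ m) atTop (𝓝 0) := by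
    have := (tendsto_pow_atTop_nhds_zero_of_lt_one (by norm_num : (0 : ℝ) ≤ 1 / 2)
      (by norm_num)).const_mul (C * ‖(1 : A)‖)
    rwa [mul_zero] at this
  exact absurd (ge_of_tendsto' hlim key) (not_le.mpr (by positivity))

/-! ### Functions in `C¹[0,1]` -/

namespace C1I

/-- The element of `C¹[0,1]` given by a continuous function with a `C¹` extension. -/
def ofContDiffOn (f : C(I, ℂ)) (h : ContDiffOn ℝ 1 (IccExtend (zero_le_one' ℝ) f) (Icc 0 1)) :
    C1I :=
  (⟨f, h⟩ : C1Subalgebra)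

/-- The coordinate function `x ↦ x`. -/
def coord : C1I :=
  ofContDiffOn ⟨fun x => ((x : ℝ) : ℂ), by fun_prop⟩ <|
    Complex.ofRealCLM.contDiff.contDiffOn.congr fun _ hx => IccExtend_of_mem _ _ hx

theorem coord_apply (x : I) : coord x = ((x : ℝ) : ℂ) := rfl

theorem deriv_coord (x : I) : coord.deriv x = 1 :=
  deriv_eq <| (Complex.ofRealCLM.hasDerivWithinAt (s := Icc 0 1) (x := (x : ℝ))).congr
    (fun _ ht => IccExtend_of_mem _ _ ht) (IccExtend_val _ _ _)

/-- The function `|f| ^ p` for `p > 1`. -/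
noncomputable def normRpow (f : C1I) {p : ℝ} (hp : 1 < p) : C1I :=
  ofContDiffOn ⟨fun x => ((‖f x‖ ^ p : ℝ) : ℂ), Complex.continuous_ofReal.comp
      ((toCont f).continuous.norm.rpow_const fun _ => Or.inr (by linarith))⟩ <|
    Complex.ofRealCLM.contDiff.comp_contDiffOn
      ((contDiff_norm_rpow hp).comp_contDiffOn f.contDiffOn_ext)

theorem normRpow_apply (f : C1I) {p : ℝ} (hp : 1 < p) (x : I) :
    f.normRpow hp x = ((‖f x‖ ^ p : ℝ) : ℂ) := rfl

theorem add_apply (f g : C1I) (x : I) : (f + g) x = f x + g x := rfl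

theorem sub_apply (f g : C1I) (x : I) : (f - g) x = f x - g x := rfl

theorem smul_apply (c : ℂ) (f : C1I) (x : I) : (c • f) x = c * f x := rfl

theorem one_apply (x : I) : (1 : C1I) x = 1 := rfl

theorem zero_apply (x : I) : (0 : C1I) x = 0 := rfl

theorem algebraMap_apply (c : ℂ) (x : I) : algebraMap ℂ C1I c x = c := rfl

theorem deriv_sub (f g : C1I) : (f - g).deriv = f.deriv - g.deriv := by
  rw [sub_eq_add_neg, deriv_add, deriv_neg, sub_eq_add_neg]

theorem deriv_algebraMap (c : ℂ) : (algebraMap ℂ C1I c).deriv = 0 :=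
  ContinuousMap.ext fun x => deriv_eq (hasDerivWithinAt_const (x : ℝ) (Icc 0 1) c)

theorem deriv_evalOne (x₀ : I) (f : C1I) : (evalOne x₀ f).deriv = 0 := deriv_algebraMap _

theorem norm_apply_le (f : C1I) (x : I) : ‖f x‖ ≤ ‖f‖ :=
  ((toCont f).norm_coe_le_norm x).trans (norm_toCont_le f)

theorem norm_deriv_apply_le (f : C1I) (x : I) : ‖f.deriv x‖ ≤ ‖f‖ :=
  (f.deriv.norm_coe_le_norm x).trans (norm_deriv_le f)

theorem norm_toCont_le_of_apply_eq_zero (f : C1I) {x₀ : I} (h : f x₀ = 0) :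
    ‖toCont f‖ ≤ ‖f.deriv‖ := by
  refine (ContinuousMap.norm_le _ (norm_nonneg _)).mpr fun x => ?_
  have hmv := (convex_Icc (0 : ℝ) 1).norm_image_sub_le_of_norm_hasDerivWithin_le
    (f := f.ext) (f' := fun t => IccExtend (zero_le_one' ℝ) f.deriv t) (C := ‖f.deriv‖)
    (fun t ht => by
      have := f.hasDerivWithinAt ⟨t, ht⟩
      rwa [← IccExtend_of_mem (zero_le_one' ℝ) f.deriv ht] at this)
    (fun t _ => f.deriv.norm_coe_le_norm _) x₀.2 x.2
  rw [ext_apply, ext_apply, h, sub_zero] at hmv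
  refine hmv.trans (mul_le_of_le_one_right (norm_nonneg _) ?_)
  rw [Real.norm_eq_abs, abs_le]
  constructor <;> linarith [x.2.1, x.2.2, x₀.2.1, x₀.2.2]

/-- An element of `C¹[0,1]` in a finite-dimensional subalgebra is constant. -/
theorem apply_eq_of_mem_finiteDimensional (A : Subalgebra ℂ C1I) [FiniteDimensional ℂ A]
    {f : C1I} (hf : f ∈ A) (x y : I) : f x = f y := by
  -- All values of `f` are roots of one monic polynomial, so its range is finite as well as
  -- connected.
  obtain ⟨p, hp, hp0⟩ := (Algebra.IsIntegral.isIntegral (R := ℂ) (⟨f, hf⟩ : A))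
  have hp1 : Polynomial.aeval f p = 0 := by
    have := congrArg A.val hp0
    rwa [← Polynomial.aeval_def, ← Polynomial.aeval_algHom_apply, map_zero] at this
  have hroot : ∀ x : I, p.eval (f x) = 0 := fun x => by
    have h := congrArg (fun g => toCont g x) hp1
    simp only [← Polynomial.aeval_algHom_apply, map_zero] at h
    have h2 := Polynomial.aeval_algHom_apply (ContinuousMap.evalAlgHom ℂ ℂ x) (toCont f) p
    have h3 : (ContinuousMap.evalAlgHom ℂ ℂ x) (Polynomial.aeval (toCont f) p) = 0 := h
    rw [h3, Polynomial.coe_aeval_eq_eval] at h2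
    exact h2
  have hfin : (Set.range f).Finite := by
    refine (p.roots.toFinset.finite_toSet).subset ?_
    rintro _ ⟨x, rfl⟩
    simp [hp.ne_zero, hroot x]
  have hconn : IsPreconnected (Set.range f) := isPreconnected_range (toCont f).continuous
  exact hfin.countable.isTotallyDisconnected _ subset_rfl hconn ⟨x, rfl⟩ ⟨y, rfl⟩

theorem evalOne_mul_self (x₀ : I) : evalOne x₀ * evalOne x₀ = evalOne x₀ := rfl

theorem evalOne_ne_zero (x₀ : I) : evalOne x₀ ≠ 0 := fun h => by
  have := congrArg (fun L : C1I →L[ℂ] C1I => L 1 x₀) h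
  exact one_ne_zero (α := ℂ) this

theorem finiteDimensional_rangeSpace_evalOne (x₀ : I) :
    FiniteDimensional ℂ (rangeSpace (evalOne x₀)) := by
  refine Submodule.finiteDimensional_of_le (S₂ := Submodule.span ℂ {(1 : C1I)}) ?_
  rintro _ ⟨f, rfl⟩
  exact Submodule.mem_span_singleton.mpr ⟨f x₀, (Algebra.algebraMap_eq_smul_one _).symm⟩

/-! ### Composition operators and their iterates -/

section Composition

variable {φ : I → I} {T : C1I → C1I}

/-- The symbol of a composition operator on `C¹[0,1]` is continuously differentiable. -/
theorem exists_hasDerivAtUnit (hφ : ∀ (f : C1I) (x : I), T f x = f (φ x)) :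
    Continuous φ ∧ ∃ d : C(I, ℝ), ∀ x, HasDerivAtUnit φ (d x) x := by
  -- The symbol is recovered as the image of the coordinate function.
  have hc : Continuous fun x => (T coord x).re :=
    Complex.continuous_re.comp (toCont (T coord)).continuous
  simp only [hφ, coord_apply, Complex.ofReal_re] at hc
  refine ⟨hc.subtype_mk fun x => (φ x).2,
    ⟨fun x => ((T coord).deriv x).re, by fun_prop⟩, fun x => ?_⟩
  have h := Complex.reCLM.hasFDerivAt.comp_hasDerivWithinAt (x : ℝ) ((T coord).hasDerivWithinAt x)
  refine h.congr (fun t ht => ?_) ?_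
  · rw [IccExtend_of_mem _ _ ht]
    change _ = ((T coord).ext t).re
    rw [show (T coord).ext t = T coord ⟨t, ht⟩ from IccExtend_of_mem _ _ ht, hφ, coord_apply,
      Complex.ofReal_re]
  · rw [IccExtend_val]
    change _ = ((T coord).ext x).re
    rw [ext_apply, hφ, coord_apply, Complex.ofReal_re]

theorem deriv_comp (hφ : ∀ (f : C1I) (x : I), T f x = f (φ x)) (f : C1I) {x : I} {c : ℝ}
    (hc : HasDerivAtUnit φ c x) : (T f).deriv x = c • f.deriv (φ x) := by
  refine deriv_eq ?_
  have hx : IccExtend (zero_le_one' ℝ) (fun t => (φ t : ℝ)) x = φ x := IccExtend_val _ _ _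
  have h := HasDerivWithinAt.scomp_of_eq (x : ℝ) (f.hasDerivWithinAt (φ x)) hc
    (fun t _ => (φ (projIcc 0 1 (zero_le_one' ℝ) t)).2) hx.symm
  refine h.congr (fun t ht => ?_) ?_
  · rw [Function.comp_apply, IccExtend_of_mem _ _ ht, ext_apply, ← hφ]
    exact IccExtend_of_mem _ _ ht
  · rw [Function.comp_apply, hx, ext_apply, ext_apply, hφ]

end Composition

theorem hasDerivAtUnit_unique {φ : I → I} {x : I} {c c' : ℝ} (h : HasDerivAtUnit φ c x)
    (h' : HasDerivAtUnit φ c' x) : c = c' :=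
  (uniqueDiffOn_Icc zero_lt_one x x.2).eq_deriv _ h h'

/-- Every endomorphism of `C¹[0,1]` given by a composition is bounded. -/
theorem exists_continuousLinearMap_eq (T : C1I →ₐ[ℂ] C1I) {φ : I → I}
    (hφ : ∀ (f : C1I) (x : I), T f x = f (φ x)) :
    ∃ S : C1I →L[ℂ] C1I, ∀ f : C1I, S f = T f := by
  obtain ⟨-, d, hd⟩ := exists_hasDerivAtUnit hφ
  refine ⟨T.toLinearMap.mkContinuous (1 + ‖d‖) fun f => ?_, fun _ => rfl⟩
  have h1 : ‖toCont (T f)‖ ≤ ‖f‖ := (ContinuousMap.norm_le _ (norm_nonneg _)).mpr fun x => by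
    change ‖T f x‖ ≤ _
    rw [hφ]
    exact f.norm_apply_le _
  have h2 : ‖(T f).deriv‖ ≤ ‖d‖ * ‖f‖ :=
    (ContinuousMap.norm_le _ (by positivity)).mpr fun x => by
      rw [deriv_comp hφ f (hd x), norm_smul]
      exact mul_le_mul (d.norm_coe_le_norm x) (f.norm_deriv_apply_le _) (norm_nonneg _)
        (norm_nonneg _)
  change ‖T f‖ ≤ _
  rw [norm_def, add_mul, one_mul]
  exact add_le_add h1 h2

section Iterates

variable {φ : I → I} {S : C1I →L[ℂ] C1I}

theorem pow_apply_comp (hS : ∀ (f : C1I) (x : I), S f x = f (φ x)) (n : ℕ) (f : C1I) (x : I) :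
    (S ^ n) f x = f (φ^[n] x) := by
  induction n generalizing f with
  | zero => rfl
  | succ n ih =>
    rw [pow_succ, Function.iterate_succ_apply', ← hS]
    exact ih (S f)

theorem deriv_pow_comp (hS : ∀ (f : C1I) (x : I), S f x = f (φ x)) {d : C(I, ℝ)}
    (hd : ∀ x, HasDerivAtUnit φ (d x) x) (n : ℕ) (f : C1I) (x : I) :
    ((S ^ n) f).deriv x = (∏ k ∈ Finset.range n, d (φ^[k] x)) • f.deriv (φ^[n] x) := by
  induction n generalizing f with
  | zero => simp
  | succ n ih =>
    rw [pow_succ, Function.iterate_succ_apply', Finset.prod_range_succ, mul_smul,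
      ← deriv_comp hS f (hd _)]
    exact ih (S f)

theorem mul_evalOne (hS : ∀ (f : C1I) (x : I), S f x = f (φ x)) (x₀ : I) :
    S * evalOne x₀ = evalOne x₀ :=
  ContinuousLinearMap.ext fun f => DFunLike.ext _ _ fun x => hS (evalOne x₀ f) x

theorem evalOne_mul (hS : ∀ (f : C1I) (x : I), S f x = f (φ x)) {x₀ : I} (h0 : φ x₀ = x₀) :
    evalOne x₀ * S = evalOne x₀ :=
  ContinuousLinearMap.ext fun f => DFunLike.ext _ _ fun x => by
    change S f x₀ = f x₀
    rw [hS, h0]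

/-- The mixed products `S^k L` and `L S` both collapse to `L`. At `n = 0` the two sides would be `1`
and `1 - L`. -/
theorem sub_evalOne_pow (hS : ∀ (f : C1I) (x : I), S f x = f (φ x)) {x₀ : I} (h0 : φ x₀ = x₀)
    {n : ℕ} (hn : n ≠ 0) : (S - evalOne x₀) ^ n = S ^ n - evalOne x₀ := by
  induction n with
  | zero => exact absurd rfl hn
  | succ n ih =>
    rcases eq_or_ne n 0 with rfl | hn'
    · simp
    · have h : ∀ k : ℕ, S ^ k * evalOne x₀ = evalOne x₀ := fun k => by
        induction k with
        | zero => rw [pow_zero, one_mul]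
        | succ k ihk => rw [pow_succ, mul_assoc, mul_evalOne hS, ihk]
      rw [pow_succ, ih hn', sub_mul, mul_sub, mul_sub, h, evalOne_mul hS h0, evalOne_mul_self,
        pow_succ, sub_self, sub_zero]

end Iterates

end C1I

/-! ### Shrinking iterates and quasinilpotency of `S - L` -/

theorem antitone_image_iterate {α : Type*} (φ : α → α) :
    Antitone fun n : ℕ => φ^[n] '' univ :=
  antitone_nat_of_succ_le fun n => by
    rintro _ ⟨x, -, rfl⟩
    exact ⟨φ x, mem_univ _, rfl⟩

theorem apply_eq_of_iInter_image_iterate {α : Type*} {φ : α → α} {x₀ : α}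
    (h : (⋂ n : ℕ, φ^[n] '' univ) = {x₀}) : φ x₀ = x₀ := by
  have h0 : x₀ ∈ ⋂ n : ℕ, φ^[n] '' univ := h ▸ mem_singleton x₀
  have : φ x₀ ∈ ⋂ n : ℕ, φ^[n] '' univ := mem_iInter.mpr fun n => by
    obtain ⟨y, -, hy⟩ := mem_iInter.mp h0 n
    exact ⟨φ y, mem_univ _, by rw [← hy, ← Function.iterate_succ_apply,
      Function.iterate_succ_apply']⟩
  rwa [h] at this

/-- The images are compact and decreasing, so one of them already lies in `U`; this makes
convergence of the orbits uniform. -/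
theorem exists_image_iterate_subset {α : Type*} [TopologicalSpace α] [CompactSpace α] [T2Space α]
    {φ : α → α} (hc : Continuous φ) {x₀ : α} (h : (⋂ n : ℕ, φ^[n] '' univ) = {x₀}) {U : Set α}
    (hU : U ∈ 𝓝 x₀) : ∃ N : ℕ, ∀ k, N ≤ k → ∀ x, φ^[k] x ∈ U := by
  obtain ⟨N, hN⟩ := exists_subset_nhds_of_isCompact (antitone_image_iterate φ).directed_ge
    (fun n => isCompact_univ.image (hc.iterate n)) (U := U) (by
      rw [h]
      rintro _ rfl
      exact hU)
  exact ⟨N, fun k hk x => hN (antitone_image_iterate φ hk ⟨x, mem_univ _, rfl⟩)⟩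

namespace C1I

section Main

variable {φ : I → I} {S : C1I →L[ℂ] C1I}

theorem spectrum_sub_evalOne_subset (hS : ∀ (f : C1I) (x : I), S f x = f (φ x)) {x₀ : I}
    (hx₀ : (⋂ n : ℕ, φ^[n] '' univ) = {x₀}) (h0 : HasDerivAtUnit φ 0 x₀) :
    spectrum ℂ (S - evalOne x₀) ⊆ {0} := by
  obtain ⟨hc, d, hd⟩ := exists_hasDerivAtUnit hS
  have hd0 : d x₀ = 0 := hasDerivAtUnit_unique (hd x₀) h0
  have hfix := apply_eq_of_iInter_image_iterate hx₀
  refine spectrum_subset_zero_of_norm_pow_le fun ε hε => ?_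
  obtain ⟨N, hN⟩ := exists_image_iterate_subset hc hx₀ (U := {y | ‖d y‖ < ε})
    ((isOpen_lt d.continuous.norm continuous_const).mem_nhds (by simpa [hd0] using hε))
  -- The first `N + 1` chain-rule factors are bounded by `‖d‖`, the other `m` by `ε`. The 2 arises
  -- because `g x₀ = 0` bounds `sup |g|` by `sup |g'|`. Using `N + 1` keeps the exponent non-zero.
  refine ⟨2 * ‖d‖ ^ (N + 1), N + 1, fun m => ?_⟩
  rw [sub_evalOne_pow hS hfix (by lia)]
  refine ContinuousLinearMap.opNorm_le_bound _ (by positivity) fun f => ?_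
  set g : C1I := (S ^ (N + 1 + m) - evalOne x₀) f with hg
  have hgd : g.deriv = ((S ^ (N + 1 + m)) f).deriv := by
    rw [hg, _root_.sub_apply, deriv_sub, deriv_evalOne, sub_zero]
  have hg0 : g x₀ = 0 := by
    change (S ^ (N + 1 + m)) f x₀ - f x₀ = 0
    rw [pow_apply_comp hS, Function.iterate_fixed hfix, sub_self]
  have hgn : ‖g.deriv‖ ≤ ‖d‖ ^ (N + 1) * ε ^ m * ‖f‖ := by
    refine (ContinuousMap.norm_le _ (by positivity)).mpr fun x => ?_
    rw [hgd, deriv_pow_comp hS hd, norm_smul, Finset.prod_range_add, norm_mul]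
    refine mul_le_mul (mul_le_mul ?_ ?_ (norm_nonneg _) (by positivity))
      (f.norm_deriv_apply_le _) (norm_nonneg _) (by positivity)
    · rw [norm_prod]
      refine (Finset.prod_le_prod (fun _ _ => norm_nonneg _)
        fun k _ => d.norm_coe_le_norm _).trans_eq (by simp)
    · rw [norm_prod]
      refine (Finset.prod_le_prod (g := fun _ => ε) (fun _ _ => norm_nonneg _)
        fun k _ => (hN _ (by lia) x).le).trans_eq (by simp)
  rw [norm_def]
  linarith [g.norm_toCont_le_of_apply_eq_zero hg0]

end Main

end C1I

/-! ### Consequences of the Riesz property -/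

theorem mem_spectrum_of_apply_eq_smul {E : Type*} [NormedAddCommGroup E] [NormedSpace ℂ E]
    {S : E →L[ℂ] E} {μ : ℂ} {f : E} (hf : f ≠ 0) (h : S f = μ • f) : μ ∈ spectrum ℂ S := by
  by_contra hμ
  obtain ⟨V, hV⟩ := notMem_spectrum_iff_isUnit_lambdaSub.mp hμ
  refine hf ?_
  have h1 : lambdaSub S μ f = 0 := by
    change μ • f - S f = 0
    rw [h, sub_self]
  have h2 : (↑V⁻¹ : E →L[ℂ] E) ((V : E →L[ℂ] E) f) = f := DFunLike.congr_fun V.inv_mul f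
  rwa [hV, h1, map_zero, eq_comm] at h2

namespace C1I

section Riesz

variable {φ : I → I} {S : C1I →L[ℂ] C1I}

/-- The invariant functions of a Riesz composition operator are constant. -/
theorem apply_eq_of_invariant (hS : ∀ (f : C1I) (x : I), S f x = f (φ x))
    [FiniteDimensional ℂ (nullSpace (lambdaSub S 1))] {f : C1I} (hf : S f = f) (x y : I) :
    f x = f y := by
  let A : Subalgebra ℂ C1I :=
    { carrier := {f | ∀ x, f (φ x) = f x}
      mul_mem' := fun {f g} hf hg x => congrArg₂ (· * ·) (hf x) (hg x)
      add_mem' := fun {f g} hf hg x => congrArg₂ (· + ·) (hf x) (hg x)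
      algebraMap_mem' := fun c x => rfl }
  have hA : Subalgebra.toSubmodule A = nullSpace (lambdaSub S 1) := by
    ext g
    have : lambdaSub S 1 g = g - S g := by
      change (1 : ℂ) • g - S g = _
      rw [one_smul]
    constructor
    · intro hg
      change lambdaSub S 1 g = 0
      rw [this, sub_eq_zero]
      exact DFunLike.ext _ _ fun x => ((hS g x).trans (hg x)).symm
    · intro hg x
      have hg' : lambdaSub S 1 g = 0 := hg
      rw [this, sub_eq_zero] at hg'
      rw [← hS, ← hg']
  have : FiniteDimensional ℂ A := by
    change FiniteDimensional ℂ (Subalgebra.toSubmodule A)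
    rw [hA]
    infer_instance
  exact apply_eq_of_mem_finiteDimensional A (fun x => by rw [← hS, hf]) x y

theorem map_normRpow (hS : ∀ (f : C1I) (x : I), S f x = f (φ x)) {f : C1I} {μ : ℂ}
    (h : S f = μ • f) {p : ℝ} (hp : 1 < p) :
    S (f.normRpow hp) = ((‖μ‖ ^ p : ℝ) : ℂ) • f.normRpow hp :=
  DFunLike.ext _ _ fun x => by
    rw [hS, smul_apply, normRpow_apply, normRpow_apply, ← hS, h, smul_apply, norm_mul,
      Real.mul_rpow (norm_nonneg _) (norm_nonneg _), Complex.ofReal_mul]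

/-- The non-zero eigenvalues of a Riesz composition operator on `C¹[0,1]` are unimodular, since the
powers `|f| ^ p` of an eigenfunction give a continuum of eigenvalues otherwise. -/
theorem norm_eigenvalue_eq_one (hS : ∀ (f : C1I) (x : I), S f x = f (φ x))
    (hR : IsRieszOperator S) {f : C1I} (hf : f ≠ 0) {μ : ℂ} (hμ : μ ≠ 0) (h : S f = μ • f) :
    ‖μ‖ = 1 := by
  by_contra h1
  have hpos : 0 < ‖μ‖ := norm_pos_iff.mpr hμ
  -- Exponents above 1 keep `|f| ^ p` in `C¹`; their limit 1 makes the eigenvalues `v n` tend to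
  -- `‖μ‖ ≠ 0`.
  let p : ℕ → ℝ := fun n => 1 + 1 / ((n : ℝ) + 1)
  have hp : ∀ n, 1 < p n := fun n => lt_add_of_pos_right _ (by positivity)
  let v : ℕ → ℂ := fun n => ((‖μ‖ ^ p n : ℝ) : ℂ)
  have hv : ∀ n, v n ∈ spectrum ℂ S \ {0} := fun n => by
    refine ⟨mem_spectrum_of_apply_eq_smul (f := f.normRpow (hp n)) (fun h0 => hf ?_)
      (map_normRpow hS h (hp n)), ?_⟩
    · refine DFunLike.ext _ _ fun x => ?_
      have hx := DFunLike.congr_fun h0 x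
      rw [normRpow_apply, zero_apply, Complex.ofReal_eq_zero,
        Real.rpow_eq_zero (norm_nonneg _) (by linarith [hp n]), norm_eq_zero] at hx
      exact hx
    · exact Complex.ofReal_ne_zero.mpr (Real.rpow_pos_of_pos hpos _).ne'
  have hvinj : Function.Injective v := fun m n hmn => by
    have h2 := (Real.rpow_right_inj hpos h1).mp (Complex.ofReal_injective hmn)
    simpa [p] using h2
  obtain ⟨u, -, hu, hu0⟩ := hR.tendsto_zero ((infinite_range_of_injective hvinj).mono
    (range_subset_iff.mpr hv))
  have hex : ∀ n, ∃ k, u k = v n := fun n => by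
    have := hv n
    rwa [← hu] at this
  -- As `v` is injective, so is the reindexing `k`. Hence `v` inherits the limit 0 of the
  -- enumeration `u`.
  choose k hk using hex
  have hkinj : Function.Injective k := fun m n hmn => hvinj (by rw [← hk, ← hk, hmn])
  have hlim0 : Tendsto v atTop (𝓝 0) :=
    (hu0.comp hkinj.nat_tendsto_atTop).congr hk
  have hp1 : Tendsto p atTop (𝓝 1) := by
    simpa [p] using (tendsto_one_div_add_atTop_nhds_zero_nat (𝕜 := ℝ)).const_add 1
  have hlim1 : Tendsto v atTop (𝓝 ((‖μ‖ ^ (1 : ℝ) : ℝ) : ℂ)) :=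
    (Complex.continuous_ofReal.tendsto _).comp
      ((Real.continuousAt_const_rpow hpos.ne').tendsto.comp hp1)
  have := tendsto_nhds_unique hlim0 hlim1
  rw [Real.rpow_one, eq_comm, Complex.ofReal_eq_zero] at this
  exact hpos.ne' this

/-- If `μ ≠ 1`, then `f` vanishes at the fixed point. As `|μ| = 1`, the function `|f|²` is
invariant, hence constant, hence zero. -/
theorem eigenvalue_eq_one (hS : ∀ (f : C1I) (x : I), S f x = f (φ x)) (hR : IsRieszOperator S)
    {x₀ : I} (hx₀ : φ x₀ = x₀) {f : C1I} (hf : f ≠ 0) {μ : ℂ} (hμ : μ ≠ 0) (h : S f = μ • f) :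
    μ = 1 := by
  by_contra h1
  have := hR.finite_ker 1 one_ne_zero
  have hfx : f x₀ = 0 := by
    have h2 : f x₀ = μ * f x₀ := by
      rw [← smul_apply, ← h, hS, hx₀]
    have h3 : (1 - μ) * f x₀ = 0 := by linear_combination h2
    exact (mul_eq_zero.mp h3).resolve_left (sub_ne_zero.mpr (Ne.symm h1))
  have hinv : S (f.normRpow one_lt_two) = f.normRpow one_lt_two := by
    rw [map_normRpow hS h, norm_eigenvalue_eq_one hS hR hf hμ h, Real.one_rpow, Complex.ofReal_one,
      one_smul]
  refine hf (DFunLike.ext _ _ fun x => ?_)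
  have hx := apply_eq_of_invariant hS hinv x x₀
  rw [normRpow_apply, normRpow_apply, hfx, norm_zero, Real.zero_rpow two_ne_zero,
    Complex.ofReal_zero, Complex.ofReal_eq_zero,
    Real.rpow_eq_zero (norm_nonneg _) two_ne_zero, norm_eq_zero] at hx
  exact hx

/-- For a Riesz composition operator, the functions vanishing at a fixed point lie in the range of
`1 - S`. -/
theorem exists_sub_map_eq (hS : ∀ (f : C1I) (x : I), S f x = f (φ x)) (hR : IsRieszOperator S)
    {x₀ : I} (hx₀ : φ x₀ = x₀) {g : C1I} (hg : g x₀ = 0) : ∃ h : C1I, h - S h = g := by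
  have hlam : ∀ g, lambdaSub S 1 g = g - S g := fun g => by
    change (1 : ℂ) • g - S g = _
    rw [one_smul]
  have hfin := hR.finite_ker 1 one_ne_zero
  have hS1 : S 1 = 1 := DFunLike.ext _ _ fun x => by rw [hS, one_apply, one_apply]
  have hvan : ∀ r ∈ rangeSpace (lambdaSub S 1), r x₀ = 0 := by
    rintro _ ⟨r, rfl⟩
    change lambdaSub S 1 r x₀ = 0
    rw [hlam, sub_apply, hS, hx₀, sub_self]
  have hker : Module.finrank ℂ (nullSpace (lambdaSub S 1)) = 1 := by
    refine finrank_eq_one (⟨1, ?_⟩ : nullSpace (lambdaSub S 1)) ?_ ?_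
    · change lambdaSub S 1 1 = 0
      rw [hlam, hS1, sub_self]
    · exact fun h => one_ne_zero (α := ℂ)
        (congrArg (fun f : nullSpace (lambdaSub S 1) => (f : C1I) x₀) h)
    · rintro ⟨f, hf⟩
      have hf' : lambdaSub S 1 f = 0 := hf
      rw [hlam, sub_eq_zero, eq_comm] at hf'
      refine ⟨f x₀, Subtype.ext (DFunLike.ext _ _ fun x => ?_)⟩
      change f x₀ * 1 = f x
      rw [mul_one, apply_eq_of_invariant hS hf' x x₀]
  -- The kernel consists of the constants, so the range has codimension 1 and the class of `1` spans
  -- the quotient. Evaluating at `x₀` shows that the component of `g` along it is zero.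
  have hne : (rangeSpace (lambdaSub S 1)).mkQ 1 ≠ 0 := fun h => by
    rw [Submodule.mkQ_apply, Submodule.Quotient.mk_eq_zero] at h
    exact one_ne_zero (α := ℂ) (hvan 1 h)
  rw [hR.dim_eq_codim 1 one_ne_zero, finrank_eq_one_iff_of_nonzero' _ hne] at hker
  obtain ⟨c, hc⟩ := hker ((rangeSpace (lambdaSub S 1)).mkQ g)
  rw [← map_smul, Submodule.mkQ_apply, Submodule.mkQ_apply, Submodule.Quotient.eq] at hc
  have hc0 : c = 0 := by
    have := hvan _ hc
    rwa [sub_apply, hg, smul_apply, one_apply, mul_one, sub_zero] at this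
  rw [hc0, zero_smul, zero_sub, Submodule.neg_mem_iff] at hc
  obtain ⟨h, hh⟩ := hc
  exact ⟨h, (hlam h).symm.trans hh⟩

theorem isUnit_lambdaSub_sub_evalOne_one (hS : ∀ (f : C1I) (x : I), S f x = f (φ x))
    (hR : IsRieszOperator S) {x₀ : I} (hx₀ : φ x₀ = x₀) :
    IsUnit (lambdaSub (S - evalOne x₀) 1) := by
  have hlam : ∀ f x, lambdaSub (S - evalOne x₀) 1 f x = f x - (S f x - f x₀) := fun f x => by
    change 1 * f x - (S f x - f x₀) = _
    rw [one_mul]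
  have := hR.finite_ker 1 one_ne_zero
  rw [ContinuousLinearMap.isUnit_iff_bijective]
  constructor
  · rw [injective_iff_map_eq_zero]
    intro f hf
    have hpt : ∀ x, f x - (S f x - f x₀) = 0 := fun x => by
      rw [← hlam, hf, zero_apply]
    have hfx : f x₀ = 0 := by
      have := hpt x₀
      rwa [hS, hx₀, sub_self, sub_zero] at this
    have hinv : S f = f := DFunLike.ext _ _ fun x => by
      have := hpt x
      rw [hfx, sub_zero, sub_eq_zero] at this
      exact this.symm
    exact DFunLike.ext _ _ fun x => (apply_eq_of_invariant hS hinv x x₀).trans hfx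
  · intro g
    obtain ⟨h, hh⟩ := exists_sub_map_eq hS hR hx₀ (g := g - evalOne x₀ g) (sub_self (g x₀))
    -- The operator `1 - (S - L)` fixes constants and sends `h` to `g - g x₀ + h x₀`, so this
    -- constant is the needed correction.
    refine ⟨h + algebraMap ℂ C1I (g x₀ - h x₀), DFunLike.ext _ _ fun x => ?_⟩
    have hx : h x - S h x = g x - g x₀ := DFunLike.congr_fun hh x
    rw [hlam, hS, add_apply, add_apply, add_apply, algebraMap_apply, algebraMap_apply,
      algebraMap_apply, ← hS]
    linear_combination hx

theorem spectrum_sub_evalOne_subset_of_isRieszOperator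
    (hS : ∀ (f : C1I) (x : I), S f x = f (φ x)) (hR : IsRieszOperator S)
    {x₀ : I} (hx₀ : φ x₀ = x₀) : spectrum ℂ (S - evalOne x₀) ⊆ {0} := by
  intro μ hμ
  by_contra h0
  rcases eq_or_ne μ 1 with rfl | h1
  · exact notMem_spectrum_iff_isUnit_lambdaSub.mpr
      (isUnit_lambdaSub_sub_evalOne_one hS hR hx₀) hμ
  · have hμS : μ ∈ spectrum ℂ S := by
      by_contra h
      rw [notMem_spectrum_iff_isUnit_lambdaSub, isUnit_lambdaSub_iff_sub (mul_evalOne hS x₀)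
        (evalOne_mul hS hx₀) (evalOne_mul_self x₀) h0 h1,
        ← notMem_spectrum_iff_isUnit_lambdaSub] at h
      exact h hμ
    obtain ⟨f, hf⟩ := (hR.hasEigenvalue μ hμS h0).exists_hasEigenvector
    exact h1 (eigenvalue_eq_one hS hR hx₀ hf.2 h0 hf.apply_eq_smul)

/-- The functional `f ↦ f'(x₀)` is multiplied by `φ'(x₀)` under `S - L`. It therefore kills the
range of `φ'(x₀) - (S - L)`, which excludes the coordinate function; so `φ'(x₀)` is in the spectrum.
-/
theorem hasDerivAtUnit_zero_of_spectrum_subset (hS : ∀ (f : C1I) (x : I), S f x = f (φ x))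
    {x₀ : I} (hx₀ : φ x₀ = x₀) (hQ : spectrum ℂ (S - evalOne x₀) ⊆ {0}) :
    HasDerivAtUnit φ 0 x₀ := by
  obtain ⟨-, d, hd⟩ := exists_hasDerivAtUnit hS
  suffices h : d x₀ = 0 by
    have := hd x₀
    rwa [h] at this
  by_contra h
  have hu : IsUnit (lambdaSub (S - evalOne x₀) (d x₀ : ℂ)) :=
    notMem_spectrum_iff_isUnit_lambdaSub.mp fun hm => h (Complex.ofReal_eq_zero.mp (hQ hm))
  obtain ⟨f, hf⟩ := (ContinuousLinearMap.isUnit_iff_bijective.mp hu).2 coord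
  have h1 : (((d x₀ : ℂ) • f - (S f - evalOne x₀ f)).deriv) x₀ = 1 := by
    rw [← deriv_coord x₀, ← hf]
    rfl
  rw [deriv_sub, deriv_sub, deriv_smul, deriv_evalOne, sub_zero, ContinuousMap.sub_apply,
    ContinuousMap.smul_apply, deriv_comp hS f (hd x₀), hx₀, Complex.real_smul, smul_eq_mul,
    sub_self] at h1
  exact zero_ne_one h1

/-- A point `y = φ_n(x)` of the intersection differs from `x₀` by the value at `x` of `(S - L)^n`
applied to the coordinate function, and these norms tend to 0. -/
theorem iInter_image_iterate_of_spectrum_subset (hS : ∀ (f : C1I) (x : I), S f x = f (φ x))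
    {x₀ : I} (hx₀ : φ x₀ = x₀) (hQ : spectrum ℂ (S - evalOne x₀) ⊆ {0}) :
    (⋂ n : ℕ, φ^[n] '' univ) = {x₀} := by
  refine Subset.antisymm (fun y hy => ?_) (singleton_subset_iff.mpr (mem_iInter.mpr fun n =>
    ⟨x₀, mem_univ _, Function.iterate_fixed hx₀ n⟩))
  have hle : ∀ n : ℕ, n ≠ 0 →
      ‖((y : ℝ) : ℂ) - ((x₀ : ℝ) : ℂ)‖ ≤ ‖(S - evalOne x₀) ^ n‖ * ‖coord‖ := by
    intro n hn
    obtain ⟨x, -, rfl⟩ := mem_iInter.mp hy n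
    have h1 := (((S - evalOne x₀) ^ n) coord).norm_apply_le x
    have h2 : ((S - evalOne x₀) ^ n) coord x = ((φ^[n] x : ℝ) : ℂ) - ((x₀ : ℝ) : ℂ) := by
      rw [sub_evalOne_pow hS hx₀ hn]
      change (S ^ n) coord x - coord x₀ = _
      rw [pow_apply_comp hS, coord_apply, coord_apply]
    rw [h2] at h1
    exact h1.trans (ContinuousLinearMap.le_opNorm _ _)
  have hlim : Tendsto (fun n : ℕ => (1 / 2 : ℝ) ^ n * ‖coord‖) atTop (𝓝 0) := by
    have := (tendsto_pow_atTop_nhds_zero_of_lt_one (by norm_num : (0 : ℝ) ≤ 1 / 2)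
      (by norm_num)).mul_const ‖coord‖
    rwa [zero_mul] at this
  have hev : ∀ᶠ n : ℕ in atTop,
      ‖((y : ℝ) : ℂ) - ((x₀ : ℝ) : ℂ)‖ ≤ (1 / 2 : ℝ) ^ n * ‖coord‖ := by
    filter_upwards [(tendsto_norm_pow_one_div_of_spectrum_subset hQ).eventually_lt_const
      (by norm_num : (0 : ℝ) < 1 / 2), eventually_ne_atTop 0] with n hn hn0
    refine (hle n hn0).trans (mul_le_mul_of_nonneg_right ?_ (norm_nonneg _))
    have h3 := pow_le_pow_left₀ (by positivity) hn.le n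
    rwa [one_div (n : ℝ), Real.rpow_inv_natCast_pow (norm_nonneg _) hn0] at h3
  have h0 := norm_le_zero_iff.mp (ge_of_tendsto hlim hev)
  exact Subtype.ext (Complex.ofReal_injective (sub_eq_zero.mp h0))

end Riesz

end C1I

theorem theorem3p1 (T : C1I →ₐ[ℂ] C1I) (φ : I → I) (hφ : ∀ (f : C1I) (x : I), T f x = f (φ x)) :
    ∃ S : C1I →L[ℂ] C1I, (∀ f : C1I, S f = T f) ∧
      (IsRieszOperator S ↔
        ∃ x₀ : I, (⋂ n : ℕ, φ^[n] '' univ) = {x₀} ∧ HasDerivAtUnit φ 0 x₀) ∧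
      (∀ x₀ : I, (⋂ n : ℕ, φ^[n] '' univ) = {x₀} → HasDerivAtUnit φ 0 x₀ →
        Tendsto (fun n : ℕ => ‖S ^ n - C1I.evalOne x₀‖ ^ (1 / (n : ℝ))) atTop (𝓝 0)) := by
  obtain ⟨S, hST⟩ := C1I.exists_continuousLinearMap_eq T hφ
  have hS : ∀ (f : C1I) (x : I), S f x = f (φ x) := fun f x => by rw [hST, hφ]
  refine ⟨S, hST, ⟨fun hR => ?_, ?_⟩, fun x₀ hx₀ h0 => ?_⟩
  · obtain ⟨hc, -⟩ := C1I.exists_hasDerivAtUnit hS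
    -- The intermediate value theorem supplies the candidate `x₀`.
    obtain ⟨x₀, -, hx₀⟩ := exists_mem_Icc_isFixedPt (a := (0 : I)) (b := 1) hc.continuousOn
      zero_le_one nonneg' le_one'
    have hQ := C1I.spectrum_sub_evalOne_subset_of_isRieszOperator hS hR hx₀
    exact ⟨x₀, C1I.iInter_image_iterate_of_spectrum_subset hS hx₀ hQ,
      C1I.hasDerivAtUnit_zero_of_spectrum_subset hS hx₀ hQ⟩
  · rintro ⟨x₀, hx₀, h0⟩
    have := C1I.finiteDimensional_rangeSpace_evalOne x₀
    exact isRieszOperator_of_quasinilpotent_sub (C1I.mul_evalOne hS x₀)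
      (C1I.evalOne_mul hS (apply_eq_of_iInter_image_iterate hx₀)) (C1I.evalOne_mul_self x₀)
      (C1I.evalOne_ne_zero x₀) (C1I.spectrum_sub_evalOne_subset hS hx₀ h0)
  · refine (tendsto_norm_pow_one_div_of_spectrum_subset
      (C1I.spectrum_sub_evalOne_subset hS hx₀ h0)).congr' ?_
    -- `(S - L)^n` and `S^n - L` are identified only for `n ≠ 0`, which is enough for the limit.
    filter_upwards [eventually_ne_atTop 0] with n hn
    rw [C1I.sub_evalOne_pow hS (apply_eq_of_iInter_image_iterate hx₀) hn]
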